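/- Let $\mathbb H\in\{\mathbb R,\mathbb C\}$, let $d\ge 2$, and let $A\in\mathbb H^{m\times d}$. Write $|Ax|\in\mathbb R^m$ for the vector of entrywise absolute values of $Ax$, and suppose that $A$ has the phase retrieval property: whenever $|Ax|=|Ay|$ with $x,y\in\mathbb H^d$, there is $c\in\mathbb H$ with $|c|=1$ and $x=cy$. All norms are Euclidean. Put $\mathcal K_A=\{|Ax| : x\in\mathbb H^d\}\subset\mathbb R^m$. For $b\in\mathbb R^m$ let $$\Phi_A(b)=\operatorname*{arg\,min}_{x\in\mathbb H^d}\big\||Ax|-b\big\|^2,\qquad P_{\mathcal K_A}(b)=\operatorname*{arg\,min}_{y\in\mathcal K_A}\|y-b\|$$ be the full sets of minimizers, let $U_A=\{b\in\mathbb R^m : \#P_{\mathcal K_A}(b)=1\}$, and let $\mathrm{dist}(S,T)=\inf_{x\in S,\,y\in T}\|x-y\|$ for $S,T\subset\mathbb H^d$. Then: 1. For every $\varepsilon>0$ there are $b_1,b_2\in U_A$ with $b_1\ne b_2$ and $$\|b_1-b_2\|\le\varepsilon\cdot\mathrm{dist}(\Phi_A(b_1),\Phi_A(b_2)).$$ 2.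 Consequently the solution map is not uniformly Lipschitz stable: there is no constant $C$ such that $\mathrm{dist}(\Phi_A(b_1),\Phi_A(b_2))\le C\|b_1-b_2\|$ for all $b_1,b_2\in U_A$. 3. Moreover, there are $b_0\in\mathbb R^m$ and two distinct points $y_1,y_2\in P_{\mathcal K_A}(b_0)$ such that, for every $\varepsilon>0$, the vectors in 1 can be taken to be $b_1=ty_1+(1-t)b_0$ and $b_2=ty_2+(1-t)b_0$ for some $t\in(0,1)$. -/

import Mathlib

open scoped Matrix

noncomputable section

namespace PhaseLS

variable {𝕜 : Type*} [RCLike 𝕜] {m d : ℕ}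

/-- The vector `|A x| ∈ ℝ^m` of entrywise absolute values of `A x`. -/
def absMap (A : Matrix (Fin m) (Fin d) 𝕜) (x : EuclideanSpace 𝕜 (Fin d)) :
    EuclideanSpace ℝ (Fin m) :=
  WithLp.toLp 2 (fun i => ‖(A *ᵥ x.ofLp) i‖)

/-- `A` has the phase retrieval property: `|A x|` determines `x` up to a unimodular constant. -/
def PhaseRetrieval (A : Matrix (Fin m) (Fin d) 𝕜) : Prop :=
  ∀ x y : EuclideanSpace 𝕜 (Fin d), absMap A x = absMap A y → ∃ c : 𝕜, ‖c‖ = 1 ∧ x = c • y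

/-- The phaseless surface `K_A = {|A x| : x ∈ 𝕜^d}`. -/
def surface (A : Matrix (Fin m) (Fin d) 𝕜) : Set (EuclideanSpace ℝ (Fin m)) :=
  Set.range (absMap A)

/-- `Φ_A(b)`, the set of all minimizers of `‖|A x| - b‖²` over `x ∈ 𝕜^d`. -/
def solutions (A : Matrix (Fin m) (Fin d) 𝕜) (b : EuclideanSpace ℝ (Fin m)) :
    Set (EuclideanSpace 𝕜 (Fin d)) :=
  {x | ∀ z, ‖absMap A x - b‖ ^ 2 ≤ ‖absMap A z - b‖ ^ 2}

/-- `P_K(b)`, the set of all best approximations to `b` from `K`. -/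
def bestApprox (K : Set (EuclideanSpace ℝ (Fin m))) (b : EuclideanSpace ℝ (Fin m)) :
    Set (EuclideanSpace ℝ (Fin m)) :=
  {y | y ∈ K ∧ ∀ z ∈ K, ‖y - b‖ ≤ ‖z - b‖}

/-- `U_A`, the set of vectors with exactly one best approximation from `K_A`. -/
def uniqueSet (A : Matrix (Fin m) (Fin d) 𝕜) : Set (EuclideanSpace ℝ (Fin m)) :=
  {b | (bestApprox (surface A) b).encard = 1}

/-- The distance between two sets of vectors, the infimum of `‖x - y‖` over `x ∈ S`, `y ∈ T`.
The sets `Φ_A(b)` are never empty, and when `S` and `T` are the orbits of `x` and `y` under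
unimodular constants this is the distance `min_{|c| = 1} ‖x - c y‖` of the two classes. -/
def setDist (S T : Set (EuclideanSpace 𝕜 (Fin d))) : ℝ :=
  sInf {r : ℝ | ∃ x ∈ S, ∃ y ∈ T, r = ‖x - y‖}

end PhaseLS

end

/-! Instability comes from a point `b₀` with two nearest points `y₁ ≠ y₂` in the surface. Moving
from `b₀` a fraction `t` of the way to `yᵢ` makes `yᵢ` the only nearest point
(`bestApprox_smul_add`). The data then differ by `t • (y₁ - y₂)`, while the solution sets stay at
least `‖y₁ - y₂‖ / L` apart, `L` being a Lipschitz constant of `absMap A`; let `t` tend to 0.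

Such a `b₀` exists because the surface is closed but not convex, so Motzkin's theorem
(`convex_of_unique_nearest`) rules out unique nearest points everywhere. As for non-convexity: a
convex cone is closed under sums, and for the vectors `u`, `v` of `exists_dual_pair` a sum of two
elements of `|A span(u, v)|` is again `|A z|` with `z` in that span. Over the reals this fails at
one entry; over the complex numbers it yields two non-proportional vectors with equal absolute
values. -/

namespace PhaseLS

/-! ### Motzkin's theorem on closed sets with unique nearest points. -/

section Motzkin

variable {E : Type*} [NormedAddCommGroup E] [InnerProductSpace ℝ E] [ProperSpace E]

/-- Moving the centre `c` away from its unique nearest point `p` in a closed set `K` increases the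
distance to `K`. -/
theorem eventually_infDist_lt_infDist_add_smul {K : Set E} (hK : IsClosed K) {c p v : E}
    (hp : p ∈ K) (hu : ∀ k ∈ K, dist c k ≤ Metric.infDist c K → k = p)
    (hv : inner ℝ v (p - c) < 0) :
    ∀ᶠ δ in nhdsWithin (0 : ℝ) (Set.Ioi 0),
      Metric.infDist c K < Metric.infDist (c + δ • v) K := by
  set r := Metric.infDist c K
  set C : Set E := K ∩ {k | 0 ≤ inner ℝ v (k - c)} with hC
  have hCcl : IsClosed C := hK.inter (isClosed_le continuous_const (by fun_prop))
  -- `p` lies outside `C`, so uniqueness and closedness give a uniform margin on `C`. A step shorter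
  -- than the margin cannot use it up; the points of `K` outside `C` recede.
  have hη : ∃ η > 0, ∀ k ∈ C, r + η ≤ dist c k := by
    rcases C.eq_empty_or_nonempty with h | h
    · exact ⟨1, one_pos, by simp [h]⟩
    · obtain ⟨k, hk, hkd⟩ := hCcl.exists_infDist_eq_dist h c
      have hlt : r < dist c k := by
        by_contra! hle
        have := hu k hk.1 hle
        subst this
        exact absurd hk.2 (not_le.2 hv)
      refine ⟨dist c k - r, sub_pos.2 hlt, fun k' hk' => ?_⟩
      have := Metric.infDist_le_dist_of_mem (x := c) hk'
      linarith
  obtain ⟨η, hη0, hη⟩ := hη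
  have hsmall : ∀ᶠ δ in nhdsWithin (0 : ℝ) (Set.Ioi 0), ‖δ • v‖ < η := by
    apply Filter.Eventually.filter_mono nhdsWithin_le_nhds
    have : ContinuousAt (fun δ : ℝ => ‖δ • v‖) 0 := by fun_prop
    exact this.eventually_lt_const (by simpa using hη0)
  filter_upwards [hsmall, self_mem_nhdsWithin] with δ hδ hδ0
  obtain ⟨q, hq, hqd⟩ := hK.exists_infDist_eq_dist ⟨p, hp⟩ (c + δ • v)
  rw [hqd]
  by_cases hqC : 0 ≤ inner ℝ v (q - c)
  · have h1 := hη q ⟨hq, hqC⟩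
    have h2 : dist c q ≤ dist c (c + δ • v) + dist (c + δ • v) q := dist_triangle _ _ _
    have h3 : dist c (c + δ • v) = ‖δ • v‖ := by simp [dist_eq_norm]
    linarith
  · push Not at hqC
    have h1 : r ≤ dist c q := Metric.infDist_le_dist_of_mem hq
    refine lt_of_le_of_lt h1 ?_
    rw [dist_eq_norm, dist_eq_norm]
    refine lt_of_pow_lt_pow_left₀ 2 (norm_nonneg _) ?_
    have h4 : c + δ • v - q = δ • v - (q - c) := by abel
    rw [h4, norm_sub_rev c q, norm_sub_sq_real (δ • v), inner_smul_left]
    simp only [conj_trivial]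
    have := mul_neg_of_pos_of_neg (Set.mem_Ioi.1 hδ0) hqC
    nlinarith [sq_nonneg ‖δ • v‖]

/-- **Motzkin's theorem**: a closed set in which every point has at most one nearest point is
convex. -/
theorem convex_of_unique_nearest {K : Set E} (hK : IsClosed K)
    (hu : ∀ c, ∀ p ∈ K, ∀ q ∈ K, (∀ k ∈ K, dist c p ≤ dist c k) → (∀ k ∈ K, dist c q ≤ dist c k) →
      p = q) : Convex ℝ K := by
  intro x hx y hy a b ha hb hab
  set z := a • x + b • y with hz
  by_contra hzK
  have hne : K.Nonempty := ⟨x, hx⟩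
  have hpos : 0 < Metric.infDist z K := (hK.notMem_iff_infDist_pos hne).1 hzK
  obtain ⟨r₀, hr₀, hr₀z⟩ : ∃ r₀ > 0, Metric.infDist z K = 2 * r₀ :=
    ⟨Metric.infDist z K / 2, by positivity, by ring⟩
  -- Centres `c` of balls missing `K` and still containing `z` with room `r₀`. A largest such ball
  -- exists by compactness, and uniqueness of its nearest point allows a larger one.
  set S : Set E := {c | r₀ ≤ Metric.infDist c K - dist c z} with hS
  have hcont : Continuous fun c => Metric.infDist c K := Metric.continuous_infDist_pt K
  have hScl : IsClosed S := isClosed_le continuous_const (by fun_prop)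
  have hSb : S ⊆ Metric.closedBall z (a * b * ‖x - y‖ ^ 2 / (2 * r₀)) := by
    intro c hc
    have hc' : r₀ ≤ Metric.infDist c K - dist c z := hc
    have hcx : Metric.infDist c K ≤ dist c x := Metric.infDist_le_dist_of_mem hx
    have hcy : Metric.infDist c K ≤ dist c y := Metric.infDist_le_dist_of_mem hy
    have hD : 0 ≤ dist c z := dist_nonneg
    have e1 : c - z = a • (c - x) + b • (c - y) := by
      have : c = a • c + b • c := by rw [← add_smul, hab, one_smul]
      rw [hz, smul_sub, smul_sub]; nth_rewrite 1 [this]; abel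
    have e2 : x - y = (c - y) - (c - x) := by abel
    have e3 : dist c z ^ 2 = a * dist c x ^ 2 + b * dist c y ^ 2 - a * b * ‖x - y‖ ^ 2 := by
      rw [dist_eq_norm, dist_eq_norm, dist_eq_norm, e1, e2, norm_add_sq_real, norm_sub_sq_real (c - y),
        norm_smul, norm_smul, inner_smul_left, inner_smul_right, Real.norm_of_nonneg ha,
        Real.norm_of_nonneg hb, real_inner_comm (c - x) (c - y)]
      simp only [conj_trivial]
      have : b = 1 - a := by linarith
      subst this; ring
    rw [Metric.mem_closedBall, le_div_iff₀ (by positivity)]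
    have hx2 : (r₀ + dist c z) ^ 2 ≤ dist c x ^ 2 := by
      apply pow_le_pow_left₀ <;> linarith
    have hy2 : (r₀ + dist c z) ^ 2 ≤ dist c y ^ 2 := by
      apply pow_le_pow_left₀ <;> linarith
    have h5 : (a + b) * (r₀ + dist c z) ^ 2 ≤ a * dist c x ^ 2 + b * dist c y ^ 2 := by
      nlinarith [mul_le_mul_of_nonneg_left hx2 ha, mul_le_mul_of_nonneg_left hy2 hb]
    rw [hab] at h5
    nlinarith
  have hSc : IsCompact S := (isCompact_closedBall _ _).of_isClosed_subset hScl hSb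
  have hzS : z ∈ S := by
    simp only [hS, Set.mem_ofPred_eq, dist_self]; linarith
  obtain ⟨c, hc, hmax⟩ := hSc.exists_isMaxOn ⟨z, hzS⟩ hcont.continuousOn
  obtain ⟨p, hp, hpd⟩ := hK.exists_infDist_eq_dist hne c
  have huniq : ∀ k ∈ K, dist c k ≤ Metric.infDist c K → k = p := fun k hk hkd =>
    hu c k hk p hp (fun l hl => hkd.trans (Metric.infDist_le_dist_of_mem hl))
      (fun l hl => hpd ▸ Metric.infDist_le_dist_of_mem hl)
  have hc' : r₀ ≤ Metric.infDist c K - dist c z := hc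
  have hrpos : 0 < ‖p - c‖ := by
    rw [norm_sub_rev, ← dist_eq_norm, ← hpd]
    linarith [dist_nonneg (x := c) (y := z)]
  suffices h : ∃ v, inner ℝ v (p - c) < 0 ∧
      ∀ᶠ δ in nhdsWithin (0 : ℝ) (Set.Ioi 0), Metric.infDist c K < Metric.infDist (c + δ • v) K →
        c + δ • v ∈ S by
    obtain ⟨v, hv, hvS⟩ := h
    obtain ⟨δ, h1, h2⟩ :=
      ((eventually_infDist_lt_infDist_add_smul hK hp huniq hv).and hvS).exists
    exact absurd (hmax (h2 h1)) (not_le.2 h1)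
  rcases hc'.lt_or_eq with hlt | heq
  · refine ⟨-(p - c), ?_, ?_⟩
    · rw [inner_neg_left, real_inner_self_eq_norm_sq]
      have := pow_pos hrpos 2
      linarith
    · apply Filter.Eventually.filter_mono nhdsWithin_le_nhds
      have : ContinuousAt (fun δ : ℝ => Metric.infDist (c + δ • -(p - c)) K -
          dist (c + δ • -(p - c)) z) 0 := by
        apply Continuous.continuousAt
        exact (hcont.comp (by fun_prop)).sub (by fun_prop)
      filter_upwards [this.eventually_const_lt (u := r₀) (by simpa using hlt)] with δ hδ _
      exact hδ.le
  -- The constraint is tight, so the move must leave `p` without receding from `z`. As `w` and `u`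
  -- are not positively parallel, `‖u‖ • w - ‖w‖ • u` does both.
  · set w := z - c with hw
    set u := p - c with hu'
    have hwn : dist c z = ‖w‖ := by rw [dist_comm, dist_eq_norm]
    have hun : Metric.infDist c K = ‖u‖ := by rw [hpd, dist_comm, dist_eq_norm]
    rw [hwn, hun] at heq
    have hzp : 2 * r₀ ≤ ‖w - u‖ := by
      rw [← hr₀z, show w - u = z - p by simp [hw, hu'], ← dist_eq_norm]
      exact Metric.infDist_le_dist_of_mem hp
    have hinn : inner ℝ w u < ‖w‖ * ‖u‖ := by
      have h1 := norm_sub_sq_real w u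
      have h2 : (2 * r₀) ^ 2 ≤ ‖w - u‖ ^ 2 := pow_le_pow_left₀ (by positivity) hzp 2
      have h3 : ‖u‖ = r₀ + ‖w‖ := by linarith
      rw [h3] at h1 ⊢
      nlinarith [pow_pos hr₀ 2]
    have hw0 : 0 < ‖w‖ := by
      refine norm_pos_iff.2 fun h => ?_
      simp [h] at hinn
    refine ⟨‖u‖ • w - ‖w‖ • u, ?_, ?_⟩
    · rw [inner_sub_left, inner_smul_left, inner_smul_left, real_inner_self_eq_norm_sq]
      simp only [conj_trivial]
      nlinarith
    · set v := ‖u‖ • w - ‖w‖ • u with hv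
      have hwv : 0 < inner ℝ w v := by
        rw [hv, inner_sub_right, inner_smul_right, inner_smul_right, real_inner_self_eq_norm_sq]
        nlinarith
      have hev : ∀ᶠ δ in nhdsWithin (0 : ℝ) (Set.Ioi 0), δ * ‖v‖ ^ 2 < 2 * inner ℝ w v := by
        apply Filter.Eventually.filter_mono nhdsWithin_le_nhds
        have : ContinuousAt (fun δ : ℝ => δ * ‖v‖ ^ 2) 0 := by fun_prop
        exact this.eventually_lt_const (by simpa using hwv)
      filter_upwards [hev, self_mem_nhdsWithin] with δ hδ hδ0 hlt
      have hδ0' : 0 < δ := hδ0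
      have hle : dist (c + δ • v) z ≤ ‖w‖ := by
        rw [dist_comm, dist_eq_norm, show z - (c + δ • v) = w - δ • v by rw [hw]; abel]
        refine (sq_le_sq₀ (norm_nonneg _) (norm_nonneg _)).1 ?_
        rw [norm_sub_sq_real, inner_smul_right, norm_smul, Real.norm_of_nonneg hδ0'.le]
        nlinarith [mul_pos hδ0' (sub_pos.2 hδ)]
      change r₀ ≤ _
      linarith

end Motzkin

/-! ### The surface: closedness and failure of convexity. -/

section Surface

variable {𝕜 : Type*} [RCLike 𝕜] {m d : ℕ}

theorem absMap_apply (A : Matrix (Fin m) (Fin d) 𝕜) (x : EuclideanSpace 𝕜 (Fin d)) (i : Fin m) :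
    absMap A x i = ‖(A *ᵥ x.ofLp) i‖ := rfl

theorem absMap_eq_iff (A : Matrix (Fin m) (Fin d) 𝕜) (x y : EuclideanSpace 𝕜 (Fin d)) :
    absMap A x = absMap A y ↔ ∀ i, ‖(A *ᵥ x.ofLp) i‖ = ‖(A *ᵥ y.ofLp) i‖ := by
  constructor
  · intro h i
    rw [← absMap_apply, h, absMap_apply]
  · intro h
    ext i
    exact h i

/-- The map `x ↦ |A x|` is Lipschitz. -/
theorem exists_norm_absMap_sub_le (A : Matrix (Fin m) (Fin d) 𝕜) :
    ∃ L : ℝ, 0 < L ∧ ∀ x y, ‖absMap A x - absMap A y‖ ≤ L * ‖x - y‖ := by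
  obtain ⟨L, hL, hLA⟩ := (LinearMap.toContinuousLinearMap A.toEuclideanLin).bound
  refine ⟨L, hL, fun x y => le_trans ?_ (hLA (x - y))⟩
  rw [EuclideanSpace.norm_eq, EuclideanSpace.norm_eq]
  refine Real.sqrt_le_sqrt (Finset.sum_le_sum fun i _ => ?_)
  refine pow_le_pow_left₀ (norm_nonneg _) ?_ 2
  have h : (LinearMap.toContinuousLinearMap A.toEuclideanLin (x - y)).ofLp i =
      (A *ᵥ x.ofLp) i - (A *ᵥ y.ofLp) i := by
    simp
  rw [h]
  exact abs_norm_sub_norm_le _ _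

/-- `K_A` is closed: it is the image of the range of `A` under entrywise absolute values, which is
a proper map. -/
theorem isClosed_surface (A : Matrix (Fin m) (Fin d) 𝕜) : IsClosed (surface A) := by
  let f : EuclideanSpace 𝕜 (Fin m) → EuclideanSpace ℝ (Fin m) :=
    fun w => WithLp.toLp 2 fun i => ‖w i‖
  have hf : Continuous f := by fun_prop
  have hn : ∀ w, ‖f w‖ = ‖w‖ := fun w => by
    rw [EuclideanSpace.norm_eq, EuclideanSpace.norm_eq]
    simp [f]
  have hp : IsProperMap f := by
    refine isProperMap_iff_tendsto_cocompact.2 ⟨hf, ?_⟩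
    rw [← Metric.cobounded_eq_cocompact, ← Metric.cobounded_eq_cocompact,
      ← tendsto_norm_atTop_iff_cobounded]
    simp only [hn]
    exact tendsto_norm_cobounded_atTop
  have hS : surface A = f '' (LinearMap.range A.toEuclideanLin : Set (EuclideanSpace 𝕜 (Fin m))) := by
    ext y
    constructor
    · rintro ⟨x, rfl⟩
      exact ⟨_, ⟨x, rfl⟩, rfl⟩
    · rintro ⟨_, ⟨x, rfl⟩, rfl⟩
      exact ⟨x, rfl⟩
  rw [hS]
  exact hp.isClosedMap _ (Submodule.closed_of_finiteDimensional _)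

/-- If the surface `K_A`, which is a cone, is convex, then it is closed under addition. -/
theorem exists_absMap_add {A : Matrix (Fin m) (Fin d) 𝕜} (hA : Convex ℝ (surface A))
    (x y : EuclideanSpace 𝕜 (Fin d)) :
    ∃ z : EuclideanSpace 𝕜 (Fin d), ∀ i,
      ‖(A *ᵥ z.ofLp) i‖ = ‖(A *ᵥ x.ofLp) i‖ + ‖(A *ᵥ y.ofLp) i‖ := by
  obtain ⟨z, hz⟩ := hA ⟨x, rfl⟩ ⟨y, rfl⟩ (a := 1 / 2) (b := 1 / 2) (by norm_num) (by norm_num)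
    (by norm_num)
  refine ⟨(2 : 𝕜) • z, fun i => ?_⟩
  have := congrArg (fun w : EuclideanSpace ℝ (Fin m) => w i) hz
  simp only [PiLp.add_apply, PiLp.smul_apply, absMap_apply, smul_eq_mul] at this
  rw [WithLp.ofLp_smul, Matrix.mulVec_smul, Pi.smul_apply, norm_smul, this, RCLike.norm_ofNat]
  ring

/-- An injective matrix with at least two columns has two vectors `u`, `v` such that every `z`
with `A z` vanishing wherever `A u` and `A v` do is a combination of `u` and `v`, with coefficients
read off from two entries of `A z`. -/
theorem exists_dual_pair (hd : 2 ≤ d) {A : Matrix (Fin m) (Fin d) 𝕜}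
    (hA : ∀ x : EuclideanSpace 𝕜 (Fin d), A *ᵥ x.ofLp = 0 → x = 0) :
    ∃ (u v : EuclideanSpace 𝕜 (Fin d)) (i j : Fin m),
      (A *ᵥ u.ofLp) i = 1 ∧ (A *ᵥ u.ofLp) j = 0 ∧ (A *ᵥ v.ofLp) i = 0 ∧ (A *ᵥ v.ofLp) j = 1 ∧
      ∀ z : EuclideanSpace 𝕜 (Fin d),
        (∀ k, (A *ᵥ u.ofLp) k = 0 → (A *ᵥ v.ofLp) k = 0 → (A *ᵥ z.ofLp) k = 0) →
        z = (A *ᵥ z.ofLp) i • u + (A *ᵥ z.ofLp) j • v := by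
  let f : Fin m → Module.Dual 𝕜 (Fin d → 𝕜) := fun i => (LinearMap.proj i).comp A.mulVecLin
  -- A maximal independent family of rows; by injectivity of `A` it is a basis of the dual, and `u`,
  -- `v` are two members of the dual basis.
  obtain ⟨κ, a, ha, hspan, hli⟩ := exists_linearIndependent' 𝕜 f
  have : Finite κ := Finite.of_injective a ha
  have : Fintype κ := Fintype.ofFinite κ
  classical
  let B : (Fin d → 𝕜) →ₗ[𝕜] (κ → 𝕜) := LinearMap.pi fun k => f (a k)
  have hBapp : ∀ x k, B x k = (A *ᵥ x) (a k) := fun x k => rfl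
  have hBinj : Function.Injective B := by
    rw [injective_iff_map_eq_zero]
    intro x hx
    have hle : Submodule.span 𝕜 (Set.range f) ≤ LinearMap.ker (Module.Dual.eval 𝕜 _ x) := by
      rw [← hspan, Submodule.span_le]
      rintro _ ⟨k, rfl⟩
      exact congrFun hx k
    have h0 : A *ᵥ x = 0 := by
      ext i
      exact hle (Submodule.subset_span ⟨i, rfl⟩)
    exact congrArg WithLp.ofLp (hA (WithLp.toLp 2 x) h0)
  have hcard : Fintype.card κ = d := by
    apply le_antisymm
    · have := hli.fintype_card_le_finrank
      rwa [Subspace.dual_finrank_eq, Module.finrank_fin_fun] at this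
    · have := LinearMap.finrank_le_finrank_of_injective hBinj
      rwa [Module.finrank_fin_fun, Module.finrank_fintype_fun_eq_card] at this
  have hBsurj : Function.Surjective B := by
    refine (LinearMap.injective_iff_surjective_of_finrank_eq_finrank ?_).1 hBinj
    rw [Module.finrank_fin_fun, Module.finrank_fintype_fun_eq_card, hcard]
  obtain ⟨k, l, hkl⟩ : ∃ k l : κ, k ≠ l := by
    have : 1 < Fintype.card κ := by omega
    exact Fintype.exists_pair_of_one_lt_card this
  obtain ⟨u, hu⟩ := hBsurj (Pi.single k 1)
  obtain ⟨v, hv⟩ := hBsurj (Pi.single l 1)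
  have hu' : ∀ n, (A *ᵥ u) (a n) = Pi.single (M := fun _ => 𝕜) k 1 n := fun n => by rw [← hu]; rfl
  have hv' : ∀ n, (A *ᵥ v) (a n) = Pi.single (M := fun _ => 𝕜) l 1 n := fun n => by rw [← hv]; rfl
  refine ⟨WithLp.toLp 2 u, WithLp.toLp 2 v, a k, a l, ?_, ?_, ?_, ?_, fun z hz => ?_⟩
  · simp [hu']
  · simp [hu', hkl.symm]
  · simp [hv', hkl]
  · simp [hv']
  · apply WithLp.ofLp_injective
    apply hBinj
    change B z.ofLp = B ((A *ᵥ z.ofLp) (a k) • u + (A *ᵥ z.ofLp) (a l) • v)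
    ext n
    simp only [hBapp, Matrix.mulVec_add, Matrix.mulVec_smul, Pi.add_apply, Pi.smul_apply,
      smul_eq_mul, hu', hv']
    by_cases h1 : n = k
    · subst h1; simp [hkl]
    by_cases h2 : n = l
    · subst h2; simp [h1]
    · simpa [h1, h2] using hz (a n) (by simp [hu', h1]) (by simp [hv', h2])

/-- Equality in the triangle inequality puts `p` and `q` on a common ray, so `p` is orthogonal to `I
* q` in the real plane. -/
theorem norm_add_I_mul_eq_of_norm_add_eq (hI : RCLike.im (RCLike.I : 𝕜) = 1) {p q : 𝕜}
    (h : ‖p + q‖ = ‖p‖ + ‖q‖) : ‖p + RCLike.I * q‖ = ‖p + -(RCLike.I * q)‖ := by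
  have hp := RCLike.norm_sq_eq_def (z := p)
  have hq := RCLike.norm_sq_eq_def (z := q)
  have hpq := RCLike.norm_sq_eq_def (z := p + q)
  rw [h] at hpq
  simp only [map_add] at hpq
  have h1 : ‖p‖ * ‖q‖ = RCLike.re p * RCLike.re q + RCLike.im p * RCLike.im q := by linarith
  have h2 : ‖p‖ ^ 2 * ‖q‖ ^ 2 =
      (RCLike.re p * RCLike.re q + RCLike.im p * RCLike.im q) ^ 2 := by rw [← h1]; ring
  rw [hp, hq] at h2
  have h3 : RCLike.re p * RCLike.im q - RCLike.im p * RCLike.re q = 0 := by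
    apply pow_eq_zero_iff two_ne_zero |>.1
    linarith
  rw [← sq_eq_sq₀ (norm_nonneg _) (norm_nonneg _), RCLike.norm_sq_eq_def, RCLike.norm_sq_eq_def]
  simp only [map_add, map_neg, RCLike.mul_re, RCLike.mul_im, RCLike.I_re, hI]
  linarith

/-- The surface of a phase retrieving matrix with at least two columns is not convex. -/
theorem PhaseRetrieval.not_convex_surface (hd : 2 ≤ d) {A : Matrix (Fin m) (Fin d) 𝕜}
    (hA : PhaseRetrieval A) : ¬ Convex ℝ (surface A) := by
  intro hconv
  have hinj : ∀ x : EuclideanSpace 𝕜 (Fin d), A *ᵥ x.ofLp = 0 → x = 0 := fun x hx => by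
    obtain ⟨c, -, h⟩ := hA x 0 ((absMap_eq_iff A x 0).2 fun i => by simp [hx])
    simpa using h
  obtain ⟨u, v, i, j, hui, huj, hvi, hvj, hspan⟩ := exists_dual_pair hd hinj
  have hmul : ∀ (α β : 𝕜) (k : Fin m), (A *ᵥ (α • u + β • v).ofLp) k =
      α * (A *ᵥ u.ofLp) k + β * (A *ᵥ v.ofLp) k := fun α β k => by
    simp [Matrix.mulVec_add, Matrix.mulVec_smul]
  -- combinations of `u` and `v` with the same absolute values have proportional coefficients
  have hPR : ∀ α β γ δ : 𝕜, (∀ k, ‖α * (A *ᵥ u.ofLp) k + β * (A *ᵥ v.ofLp) k‖ =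
      ‖γ * (A *ᵥ u.ofLp) k + δ * (A *ᵥ v.ofLp) k‖) → ∃ c : 𝕜, α = c * γ ∧ β = c * δ := by
    intro α β γ δ h
    obtain ⟨c, -, hc⟩ := hA (α • u + β • v) (γ • u + δ • v)
      ((absMap_eq_iff A _ _).2 fun k => by rw [hmul, hmul, h])
    have hk : ∀ k, α * (A *ᵥ u.ofLp) k + β * (A *ᵥ v.ofLp) k =
        c * (γ * (A *ᵥ u.ofLp) k + δ * (A *ᵥ v.ofLp) k) := fun k => by
      rw [← hmul, hc, WithLp.ofLp_smul, Matrix.mulVec_smul, Pi.smul_apply, hmul, smul_eq_mul]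
    exact ⟨c, by simpa [hui, hvi] using hk i, by simpa [huj, hvj] using hk j⟩
  -- sums of absolute values over the span of `u` and `v` come from that span
  have hsum : ∀ α β γ δ : 𝕜, ∃ s t : 𝕜, ‖s‖ = ‖α‖ + ‖γ‖ ∧ ‖t‖ = ‖β‖ + ‖δ‖ ∧
      ∀ k, ‖s * (A *ᵥ u.ofLp) k + t * (A *ᵥ v.ofLp) k‖ =
        ‖α * (A *ᵥ u.ofLp) k + β * (A *ᵥ v.ofLp) k‖ +
        ‖γ * (A *ᵥ u.ofLp) k + δ * (A *ᵥ v.ofLp) k‖ := by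
    intro α β γ δ
    obtain ⟨z, hz⟩ := exists_absMap_add hconv (α • u + β • v) (γ • u + δ • v)
    simp only [hmul] at hz
    have hzuv := hspan z fun k h1 h2 => by
      rw [← norm_eq_zero, hz, h1, h2]; simp
    refine ⟨(A *ᵥ z.ofLp) i, (A *ᵥ z.ofLp) j, ?_, ?_, fun k => ?_⟩
    · rw [hz]; simp [hui, hvi]
    · rw [hz]; simp [huj, hvj]
    · rw [← hz k, ← hmul, ← hzuv]
  rcases RCLike.I_eq_zero_or_im_I_eq_one (K := 𝕜) with hI | hI
  · -- real case
    have hsq : ∀ z : 𝕜, z = RCLike.re z := fun z => by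
      conv_lhs => rw [← RCLike.re_add_im z, hI, mul_zero, add_zero]
    -- Otherwise `u + v` and `u - v` would have equal absolute values.
    obtain ⟨k, hk1, hk2⟩ : ∃ k, (A *ᵥ u.ofLp) k ≠ 0 ∧ (A *ᵥ v.ofLp) k ≠ 0 := by
      by_contra! h
      obtain ⟨c, h1, h2⟩ := hPR 1 1 1 (-1) fun k => by
        by_cases hk : (A *ᵥ u.ofLp) k = 0
        · simp [hk]
        · simp [h k hk]
      have : (2 : 𝕜) = 0 := by linear_combination h1 + h2
      exact two_ne_zero this
    -- With `p`, `q` the entries of `A u`, `A v` at `k`, the sum there is `2|pq|`, but `|s| = 2|q|`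
    -- and `|t| = 2|p|` allow only `0` or `4|pq|`.
    obtain ⟨s, t, hs, ht, hst⟩ := hsum ((A *ᵥ v.ofLp) k) ((A *ᵥ u.ofLp) k)
      ((A *ᵥ v.ofLp) k) (-(A *ᵥ u.ofLp) k)
    have hst := hst k
    generalize (A *ᵥ u.ofLp) k = p at *
    generalize (A *ᵥ v.ofLp) k = q at *
    obtain ⟨p, rfl⟩ : ∃ p' : ℝ, p = (p' : 𝕜) := ⟨_, hsq p⟩
    obtain ⟨q, rfl⟩ : ∃ p' : ℝ, q = (p' : 𝕜) := ⟨_, hsq q⟩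
    obtain ⟨s, rfl⟩ : ∃ p' : ℝ, s = (p' : 𝕜) := ⟨_, hsq s⟩
    obtain ⟨t, rfl⟩ : ∃ p' : ℝ, t = (p' : 𝕜) := ⟨_, hsq t⟩
    have hp0 : p ≠ 0 := by simpa using hk1
    have hq0 : q ≠ 0 := by simpa using hk2
    have hst' : |s * p + t * q| = |q * p + p * q| + |q * p + -p * q| := by
      exact_mod_cast hst
    have hs' : |s| = |2 * q| := by
      rw [abs_mul, abs_two, two_mul]; simpa using hs
    have ht' : |t| = |2 * p| := by
      rw [abs_mul, abs_two, two_mul]; simpa using ht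
    have h0 : q * p + -p * q = 0 := by ring
    rw [h0, abs_zero, add_zero] at hst'
    have hpq := mul_ne_zero hp0 hq0
    rcases abs_eq_abs.1 hs' with rfl | rfl <;> rcases abs_eq_abs.1 ht' with rfl | rfl <;>
      rcases abs_eq_abs.1 hst' with h | h <;> exact hpq (by linarith)
  · -- complex case
    obtain ⟨s, t, hs, ht, hst⟩ := hsum 1 0 0 1
    simp only [norm_one, norm_zero, add_zero, zero_add, one_mul, zero_mul] at hs ht hst
    have hII : (RCLike.I : 𝕜) * RCLike.I = -1 := by
      rcases RCLike.I_mul_I (K := 𝕜) with h | h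
      · rw [h] at hI; simp at hI
      · exact h
    -- Since `s`, `t` are unimodular, `hst` is equality in the triangle inequality at every entry.
    obtain ⟨c, h1, h2⟩ := hPR s (RCLike.I * t) s (-(RCLike.I * t)) fun k => by
      have hk := hst k
      have e1 : ‖(A *ᵥ u.ofLp) k‖ = ‖s * (A *ᵥ u.ofLp) k‖ := by rw [norm_mul, hs, one_mul]
      have e2 : ‖(A *ᵥ v.ofLp) k‖ = ‖t * (A *ᵥ v.ofLp) k‖ := by rw [norm_mul, ht, one_mul]
      rw [e1, e2] at hk
      rw [neg_mul, mul_assoc]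
      generalize s * (A *ᵥ u.ofLp) k = p at *
      generalize t * (A *ᵥ v.ofLp) k = q at *
      exact norm_add_I_mul_eq_of_norm_add_eq hI hk
    have hs0 : s ≠ 0 := fun h => by simp [h] at hs
    have hc1 : c = 1 := by
      have : (c - 1) * s = 0 := by linear_combination -h1
      simpa [hs0, sub_eq_zero] using this
    have ht0 : t ≠ 0 := fun h => by simp [h] at ht
    have hI0 : (RCLike.I : 𝕜) ≠ 0 := fun h => by simp [h] at hII
    rw [hc1, one_mul, eq_neg_iff_add_eq_zero, ← two_mul] at h2
    simp [hI0, ht0] at h2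

end Surface

/-! ### Nearest points and separation of solution sets. -/

section Stability

variable {𝕜 : Type*} [RCLike 𝕜] {m d : ℕ}

/-- Moving from `b₀` towards a best approximation `y` makes `y` the only best approximation. -/
theorem bestApprox_smul_add {K : Set (EuclideanSpace ℝ (Fin m))} {b₀ y : EuclideanSpace ℝ (Fin m)}
    (hy : y ∈ bestApprox K b₀) {t : ℝ} (ht₀ : 0 < t) (ht₁ : t < 1) :
    bestApprox K (t • y + (1 - t) • b₀) = {y} := by
  have hyb : y - (t • y + (1 - t) • b₀) = (1 - t) • (y - b₀) := by module
  -- Minimality at `b₀` reads `‖z - y‖² + 2⟪z - y, y - b₀⟫ ≥ 0`; scaling the inner product by `1 -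
  -- t` leaves the surplus `t‖z - y‖²`.
  have key : ∀ z ∈ K, t * ‖z - y‖ ^ 2 + ‖y - (t • y + (1 - t) • b₀)‖ ^ 2 ≤
      ‖z - (t • y + (1 - t) • b₀)‖ ^ 2 := by
    intro z hz
    have h1 : ‖y - b₀‖ ^ 2 ≤ ‖z - b₀‖ ^ 2 := pow_le_pow_left₀ (norm_nonneg _) (hy.2 z hz) 2
    have h2 : z - b₀ = (z - y) + (y - b₀) := by abel
    have h3 : z - (t • y + (1 - t) • b₀) = (z - y) + (1 - t) • (y - b₀) := by module
    rw [h2, norm_add_sq_real] at h1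
    rw [hyb, h3, norm_add_sq_real, inner_smul_right]
    nlinarith
  ext z
  constructor
  · rintro ⟨hz, hzmin⟩
    have h1 := key z hz
    have h2 := pow_le_pow_left₀ (norm_nonneg _) (hzmin y hy.1) 2
    have h3 : ‖z - y‖ ^ 2 ≤ 0 := by
      by_contra! h
      nlinarith [mul_pos ht₀ h]
    have h4 : ‖z - y‖ = 0 := by nlinarith [norm_nonneg (z - y)]
    exact sub_eq_zero.1 (norm_eq_zero.1 h4)
  · intro hz
    obtain rfl : z = y := hz
    refine ⟨hy.1, fun x hx => (sq_le_sq₀ (norm_nonneg _) (norm_nonneg _)).1 ?_⟩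
    have := key x hx
    have := mul_nonneg ht₀.le (sq_nonneg ‖x - z‖)
    linarith

theorem mem_solutions_iff {A : Matrix (Fin m) (Fin d) 𝕜} {b : EuclideanSpace ℝ (Fin m)}
    {x : EuclideanSpace 𝕜 (Fin d)} :
    x ∈ solutions A b ↔ absMap A x ∈ bestApprox (surface A) b := by
  constructor
  · intro h
    refine ⟨⟨x, rfl⟩, ?_⟩
    rintro _ ⟨z, rfl⟩
    exact (sq_le_sq₀ (norm_nonneg _) (norm_nonneg _)).1 (h z)
  · intro h z
    exact pow_le_pow_left₀ (norm_nonneg _) (h.2 _ ⟨z, rfl⟩) 2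

/-- The solution sets of two vectors with unique best approximations `y₁` and `y₂` are at least
`‖y₁ - y₂‖ / L` apart, for a Lipschitz constant `L` of `x ↦ |A x|`. -/
theorem norm_sub_le_mul_setDist {A : Matrix (Fin m) (Fin d) 𝕜} {L : ℝ} (hL : 0 < L)
    (hLA : ∀ x y, ‖absMap A x - absMap A y‖ ≤ L * ‖x - y‖) {b₁ b₂ y₁ y₂ : EuclideanSpace ℝ (Fin m)}
    (h₁ : bestApprox (surface A) b₁ = {y₁}) (h₂ : bestApprox (surface A) b₂ = {y₂}) :
    ‖y₁ - y₂‖ ≤ L * setDist (solutions A b₁) (solutions A b₂) := by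
  have hy₁ : y₁ ∈ bestApprox (surface A) b₁ := h₁ ▸ rfl
  have hy₂ : y₂ ∈ bestApprox (surface A) b₂ := h₂ ▸ rfl
  obtain ⟨x₁, hx₁⟩ := hy₁.1
  obtain ⟨x₂, hx₂⟩ := hy₂.1
  rw [← div_le_iff₀' hL]
  -- Nonemptiness matters: the real `sInf ∅` is `0`.
  refine le_csInf ⟨_, x₁, mem_solutions_iff.2 (hx₁ ▸ hy₁), x₂, mem_solutions_iff.2 (hx₂ ▸ hy₂), rfl⟩ ?_
  rintro _ ⟨x, hx, y, hy, rfl⟩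
  rw [mem_solutions_iff, h₁] at hx
  rw [mem_solutions_iff, h₂] at hy
  rw [div_le_iff₀' hL, ← hx, ← hy]
  exact hLA x y

/-- Some vector has two distinct best approximations from the surface `K_A`. -/
theorem PhaseRetrieval.exists_two_bestApprox (hd : 2 ≤ d) {A : Matrix (Fin m) (Fin d) 𝕜}
    (hA : PhaseRetrieval A) :
    ∃ b₀ : EuclideanSpace ℝ (Fin m), ∃ y₁ ∈ bestApprox (surface A) b₀,
      ∃ y₂ ∈ bestApprox (surface A) b₀, y₁ ≠ y₂ := by
  by_contra! h
  refine hA.not_convex_surface hd (convex_of_unique_nearest (isClosed_surface A) ?_)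
  intro c p hp q hq hpc hqc
  simp only [dist_eq_norm'] at hpc hqc
  exact h c p ⟨hp, hpc⟩ q ⟨hq, hqc⟩

end Stability

end PhaseLS

theorem mainTheorem5 {𝕜 : Type*} [RCLike 𝕜] {m d : ℕ} (hd : 2 ≤ d)
    (A : Matrix (Fin m) (Fin d) 𝕜) (hA : PhaseLS.PhaseRetrieval A) :
    (∀ ε : ℝ, 0 < ε → ∃ b₁ ∈ PhaseLS.uniqueSet A, ∃ b₂ ∈ PhaseLS.uniqueSet A, b₁ ≠ b₂ ∧
      ‖b₁ - b₂‖ ≤ ε * PhaseLS.setDist (PhaseLS.solutions A b₁) (PhaseLS.solutions A b₂)) ∧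
    (¬ ∃ C : ℝ, ∀ b₁ ∈ PhaseLS.uniqueSet A, ∀ b₂ ∈ PhaseLS.uniqueSet A,
      PhaseLS.setDist (PhaseLS.solutions A b₁) (PhaseLS.solutions A b₂) ≤ C * ‖b₁ - b₂‖) ∧
    (∃ b₀ : EuclideanSpace ℝ (Fin m),
      ∃ y₁ ∈ PhaseLS.bestApprox (PhaseLS.surface A) b₀,
      ∃ y₂ ∈ PhaseLS.bestApprox (PhaseLS.surface A) b₀, y₁ ≠ y₂ ∧
        ∀ ε : ℝ, 0 < ε → ∃ t : ℝ, 0 < t ∧ t < 1 ∧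
          ∃ b₁ ∈ PhaseLS.uniqueSet A, ∃ b₂ ∈ PhaseLS.uniqueSet A,
            b₁ = t • y₁ + (1 - t) • b₀ ∧ b₂ = t • y₂ + (1 - t) • b₀ ∧ b₁ ≠ b₂ ∧
            ‖b₁ - b₂‖ ≤
              ε * PhaseLS.setDist (PhaseLS.solutions A b₁) (PhaseLS.solutions A b₂)) := by
  obtain ⟨L, hL, hLA⟩ := PhaseLS.exists_norm_absMap_sub_le A
  obtain ⟨b₀, y₁, hy₁, y₂, hy₂, hne⟩ := hA.exists_two_bestApprox hd
  have h3 : ∀ ε : ℝ, 0 < ε → ∃ t : ℝ, 0 < t ∧ t < 1 ∧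
      ∃ b₁ ∈ PhaseLS.uniqueSet A, ∃ b₂ ∈ PhaseLS.uniqueSet A,
        b₁ = t • y₁ + (1 - t) • b₀ ∧ b₂ = t • y₂ + (1 - t) • b₀ ∧ b₁ ≠ b₂ ∧
        ‖b₁ - b₂‖ ≤
          ε * PhaseLS.setDist (PhaseLS.solutions A b₁) (PhaseLS.solutions A b₂) := by
    intro ε hε
    obtain ⟨t, ht₀, ht⟩ := exists_between (lt_min one_pos (div_pos hε hL))
    obtain ⟨ht₁, htε⟩ := lt_min_iff.1 ht
    have hb₁ := PhaseLS.bestApprox_smul_add hy₁ ht₀ ht₁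
    have hb₂ := PhaseLS.bestApprox_smul_add hy₂ ht₀ ht₁
    have hsub : t • y₁ + (1 - t) • b₀ - (t • y₂ + (1 - t) • b₀) = t • (y₁ - y₂) := by module
    refine ⟨t, ht₀, ht₁, _, ?_, _, ?_, rfl, rfl, ?_, ?_⟩
    · exact (congrArg Set.encard hb₁).trans (Set.encard_singleton _)
    · exact (congrArg Set.encard hb₂).trans (Set.encard_singleton _)
    · rw [← sub_ne_zero, hsub]
      exact smul_ne_zero ht₀.ne' (sub_ne_zero.2 hne)
    · have hdist := PhaseLS.norm_sub_le_mul_setDist hL hLA hb₁ hb₂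
      rw [hsub, norm_smul, Real.norm_of_nonneg ht₀.le]
      rw [lt_div_iff₀ hL] at htε
      have hpos : 0 ≤ PhaseLS.setDist (PhaseLS.solutions A (t • y₁ + (1 - t) • b₀))
          (PhaseLS.solutions A (t • y₂ + (1 - t) • b₀)) :=
        nonneg_of_mul_nonneg_right ((norm_nonneg _).trans hdist) hL
      nlinarith [mul_le_mul_of_nonneg_left hdist ht₀.le, mul_le_mul_of_nonneg_right htε.le hpos]
  have h1 : ∀ ε : ℝ, 0 < ε → ∃ b₁ ∈ PhaseLS.uniqueSet A, ∃ b₂ ∈ PhaseLS.uniqueSet A, b₁ ≠ b₂ ∧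
      ‖b₁ - b₂‖ ≤ ε * PhaseLS.setDist (PhaseLS.solutions A b₁) (PhaseLS.solutions A b₂) := by
    intro ε hε
    obtain ⟨t, -, -, b₁, hb₁, b₂, hb₂, -, -, hb, hle⟩ := h3 ε hε
    exact ⟨b₁, hb₁, b₂, hb₂, hb, hle⟩
  refine ⟨h1, ?_, b₀, y₁, hy₁, y₂, hy₂, hne, h3⟩
  rintro ⟨C, hC⟩
  -- `|C| + 1` is positive and exceeds `C`, whatever the sign of `C`.
  have hε : 0 < 1 / (|C| + 1) := by positivity
  obtain ⟨b₁, hb₁, b₂, hb₂, hb, hle⟩ := h1 _ hε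
  have hpos : 0 < ‖b₁ - b₂‖ := norm_pos_iff.2 (sub_ne_zero.2 hb)
  rw [one_div, inv_mul_eq_div, le_div_iff₀ (by positivity)] at hle
  nlinarith [hC b₁ hb₁ b₂ hb₂, mul_le_mul_of_nonneg_right (le_abs_self C) hpos.le]
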